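/- Let $\mathcal M$ be a von Neumann algebra acting on a complex Hilbert space $H$, with predual $\mathcal M_*$ (the space of $\sigma$-weakly continuous linear functionals on $\mathcal M$) and positive cone $\mathcal M_*^+$, and let $a$ be a positive selfadjoint operator on $H$, not necessarily bounded, affiliated with $\mathcal M$. For $\lambda>0$ let $a_\lambda=\lambda\,\overline{a(\lambda+a)^{-1}}\in\mathcal M$, and for $\varphi\in\mathcal M_*^+$ put $\varphi(a)=\lim_{\lambda\to+\infty}\varphi(a_\lambda)\in[0,+\infty]$ (for bounded $a$ this is the usual value of $\varphi$ at $a$). Let $$\mathfrak D_a^+=\{\varphi\in\mathcal M_*^+ : \varphi(a)<+\infty\},\qquad \mathfrak D_a^h=\mathfrak D_a^+-\mathfrak D_a^+,$$ and let $$\|\varphi\|_a=\inf\{\varphi_1(a)+\varphi_2(a) : \varphi=\varphi_1-\varphi_2,\ \varphi_1,\varphi_2\in\mathfrak D_a^+\}\qquad(\varphi\in\mathfrak D_a^h),$$ which is a seminorm on the real vector space $\mathfrak D_a^h$. Then $\|\cdot\|_a$ is a norm on $\mathfrak D_a^h$ if and only if $a$ is injective. -/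

import Mathlib

open scoped InnerProductSpace

noncomputable section

namespace OperatorL1

variable {H : Type*} [NormedAddCommGroup H] [InnerProductSpace ℂ H] [CompleteSpace H]

/-- `a` is a positive selfadjoint operator affiliated with `M`. Here `a` is a (possibly unbounded)
operator with domain `a.domain`; selfadjointness contains the density of the domain, and
affiliation means `b a ⊆ a b` for every `b` in the commutant of `M`. -/
structure IsPosAffiliated (M : VonNeumannAlgebra H) (a : H →ₗ.[ℂ] H) : Prop where
  selfAdjoint : IsSelfAdjoint a
  nonneg : ∀ x : a.domain, 0 ≤ (⟪a x, (x : H)⟫_ℂ).re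
  affiliated : ∀ b ∈ M.commutant, ∀ x : a.domain,
    ∃ h : b (x : H) ∈ a.domain, a ⟨b (x : H), h⟩ = b (a x)

/-- The operator `r + a` (on the domain of `a`). -/
def shift (a : H →ₗ.[ℂ] H) (r : ℝ) : a.domain →ₗ[ℂ] H :=
  (r : ℂ) • a.domain.subtype + a.toFun

set_option linter.unusedSectionVars false in
theorem shift_apply (a : H →ₗ.[ℂ] H) (r : ℝ) (x : a.domain) :
    shift a r x = (r : ℂ) • (x : H) + a x := rfl

theorem IsPosAffiliated.le_norm_shift {M : VonNeumannAlgebra H} {a : H →ₗ.[ℂ] H}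
    (ha : IsPosAffiliated M a) (r : ℝ) (x : a.domain) :
    r * ‖x‖ ≤ ‖shift a r x‖ := by
  have h1 : r * ‖x‖ ^ 2 ≤ (⟪shift a r x, (x : H)⟫_ℂ).re := by
    rw [shift_apply, inner_add_left, inner_smul_left, Complex.conj_ofReal, Complex.add_re,
      Complex.re_ofReal_mul]
    have h2 : (⟪(x : H), (x : H)⟫_ℂ).re = ‖x‖ ^ 2 := inner_self_eq_norm_sq (𝕜 := ℂ) (x : H)
    have := ha.nonneg x
    rw [h2]
    linarith
  have h3 : (⟪shift a r x, (x : H)⟫_ℂ).re ≤ ‖shift a r x‖ * ‖x‖ :=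
    re_inner_le_norm (𝕜 := ℂ) (shift a r x) (x : H)
  rcases (norm_nonneg x).eq_or_lt with h | h
  · rw [← h, mul_zero]
    exact norm_nonneg _
  · refine le_of_mul_le_mul_right ?_ h
    calc r * ‖x‖ * ‖x‖ = r * ‖x‖ ^ 2 := by ring
      _ ≤ _ := h1.trans h3

theorem IsPosAffiliated.shift_injective {M : VonNeumannAlgebra H} {a : H →ₗ.[ℂ] H}
    (ha : IsPosAffiliated M a) {r : ℝ} (hr : 0 < r) : Function.Injective (shift a r) := by
  rw [injective_iff_map_eq_zero]
  intro x hx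
  have h := ha.le_norm_shift r x
  rw [hx, norm_zero] at h
  have : ‖x‖ ≤ 0 := by
    by_contra hc
    push Not at hc
    exact absurd h (not_le.mpr (mul_pos hr hc))
  exact norm_le_zero_iff.mp this

theorem IsPosAffiliated.shift_surjective {M : VonNeumannAlgebra H} {a : H →ₗ.[ℂ] H}
    (ha : IsPosAffiliated M a) {r : ℝ} (hr : 0 < r) : Function.Surjective (shift a r) := by
  have hdense : Dense (a.domain : Set H) := ha.selfAdjoint.dense_domain
  have hadj : a.adjoint = a := LinearPMap.isSelfAdjoint_def.mp ha.selfAdjoint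
  have hclosed : IsClosed (LinearMap.range (shift a r) : Set H) := by
    apply isClosed_of_closure_subset
    intro z hz
    obtain ⟨u, hu, huz⟩ := mem_closure_iff_seq_limit.mp hz
    choose x hx using hu
    have hxC : CauchySeq (fun n => (x n : H)) := by
      have huC := huz.cauchySeq
      rw [Metric.cauchySeq_iff'] at huC ⊢
      intro ε hε
      obtain ⟨N, hN⟩ := huC (r * ε) (mul_pos hr hε)
      refine ⟨N, fun n hn => ?_⟩
      have h1 := hN n hn
      have h2 := ha.le_norm_shift r (x n - x N)
      rw [map_sub, hx, hx, ← dist_eq_norm (u n) (u N)] at h2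
      have h3 : ‖x n - x N‖ < ε := lt_of_mul_lt_mul_left (h2.trans_lt h1) hr.le
      rwa [dist_eq_norm]
    obtain ⟨y, hy⟩ := cauchySeq_tendsto_of_complete hxC
    have hay : Filter.Tendsto (fun n => a (x n)) Filter.atTop (nhds (z - (r : ℂ) • y)) := by
      have := huz.sub (hy.const_smul (r : ℂ))
      refine this.congr fun n => ?_
      rw [← hx n, shift_apply]
      abel
    have hmem : (y, z - (r : ℂ) • y) ∈ a.graph := by
      have hcl : IsClosed (a.graph : Set (H × H)) := ha.selfAdjoint.isClosed
      refine hcl.mem_of_tendsto (hy.prodMk_nhds hay) (Filter.Eventually.of_forall fun n => ?_)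
      exact a.mem_graph (x n)
    rw [LinearPMap.mem_graph_iff] at hmem
    obtain ⟨w, hw1, hw2⟩ := hmem
    refine ⟨w, ?_⟩
    simp only at hw1 hw2
    rw [shift_apply, hw2, hw1]
    abel
  have htop : LinearMap.range (shift a r) = ⊤ := by
    have : (LinearMap.range (shift a r)).topologicalClosure = ⊤ := by
      rw [Submodule.topologicalClosure_eq_top_iff, Submodule.eq_bot_iff]
      intro w hw
      have hw' : ∀ x : a.domain, ⟪-((r : ℂ) • w), (x : H)⟫_ℂ = ⟪w, a x⟫_ℂ := by
        intro x
        have h := (Submodule.mem_orthogonal' _ w).mp hw _ (LinearMap.mem_range_self _ x)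
        rw [shift_apply, inner_add_right, inner_smul_right] at h
        rw [inner_neg_left, inner_smul_left, Complex.conj_ofReal]
        linear_combination -h
      have hd : w ∈ a.adjoint.domain := a.mem_adjoint_domain_of_exists w ⟨_, hw'⟩
      have hv : a.adjoint ⟨w, hd⟩ = -((r : ℂ) • w) := LinearPMap.adjoint_apply_eq hdense _ hw'
      have hd' : w ∈ a.domain := by rw [← hadj]; exact hd
      have hv' : a ⟨w, hd'⟩ = -((r : ℂ) • w) := by
        rw [← hv]
        have hle : a ≤ a.adjoint := le_of_eq hadj.symm
        exact hle.2 rfl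
      have hz : shift a r ⟨w, hd'⟩ = 0 := by
        rw [shift_apply, hv']
        simp
      have := ha.shift_injective hr (hz.trans (map_zero _).symm)
      exact congrArg Subtype.val this
    rwa [IsClosed.submodule_topologicalClosure_eq hclosed] at this
  exact LinearMap.range_eq_top.mp htop

/-- For `r > 0` there is exactly one bounded operator equal to `r a (r + a)⁻¹`, that is, sending
`(r + a) x` to `r a x` for all `x` in the domain of `a`, and it belongs to `M`. -/
theorem IsPosAffiliated.existsUnique_approx {M : VonNeumannAlgebra H} {a : H →ₗ.[ℂ] H}
    (ha : IsPosAffiliated M a) {r : ℝ} (hr : 0 < r) :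
    ∃! y : M.toStarSubalgebra, ∀ x : a.domain,
      (y : H →L[ℂ] H) ((r : ℂ) • (x : H) + a x) = (r : ℂ) • a x := by
  let e : a.domain ≃ₗ[ℂ] H :=
    LinearEquiv.ofBijective (shift a r) ⟨ha.shift_injective hr, ha.shift_surjective hr⟩
  have he : ∀ x, e x = (r : ℂ) • (x : H) + a x := fun x => rfl
  let R : H →L[ℂ] H := (a.domain.subtype ∘ₗ e.symm.toLinearMap).mkContinuous r⁻¹ (by
    intro z
    have h := ha.le_norm_shift r (e.symm z)
    have h2 : shift a r (e.symm z) = z := e.apply_symm_apply z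
    rw [h2] at h
    rw [inv_mul_eq_div, le_div_iff₀ hr, mul_comm]
    exact h)
  have hR : ∀ x : a.domain, R ((r : ℂ) • (x : H) + a x) = x := by
    intro x
    change ((e.symm (e x) : a.domain) : H) = x
    rw [e.symm_apply_apply]
  let y : H →L[ℂ] H := (r : ℂ) • (1 - (r : ℂ) • R)
  have hy : ∀ x : a.domain, y ((r : ℂ) • (x : H) + a x) = (r : ℂ) • a x := by
    intro x
    have h : y ((r : ℂ) • (x : H) + a x) = (r : ℂ) • (((r : ℂ) • (x : H) + a x) -
        (r : ℂ) • R ((r : ℂ) • (x : H) + a x)) := rfl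
    rw [h, hR, add_sub_cancel_left]
  have hyM : y ∈ M := by
    rw [← M.commutant_commutant, VonNeumannAlgebra.mem_commutant_iff]
    intro b hb
    ext z
    obtain ⟨x, rfl⟩ := e.surjective z
    obtain ⟨h, hab⟩ := ha.affiliated b hb x
    have h1 := hy ⟨b x, h⟩
    rw [hab] at h1
    rw [he]
    change b (y _) = y (b _)
    rw [hy, map_add, map_smul, map_smul, h1]
  refine ⟨⟨y, hyM⟩, hy, ?_⟩
  intro y' hy'
  apply Subtype.ext
  ext z
  obtain ⟨x, rfl⟩ := e.surjective z
  rw [he, hy' x]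
  exact (hy x).symm

open Classical in
/-- The bounded operator `a_r = r a (r + a)⁻¹`, as an element of `M`. -/
def approx (M : VonNeumannAlgebra H) (a : H →ₗ.[ℂ] H) (r : ℝ) : M.toStarSubalgebra :=
  if h : ∃ y : M.toStarSubalgebra, ∀ x : a.domain,
      (y : H →L[ℂ] H) ((r : ℂ) • (x : H) + a x) = (r : ℂ) • a x then h.choose else 0

theorem IsPosAffiliated.approx_apply {M : VonNeumannAlgebra H} {a : H →ₗ.[ℂ] H}
    (ha : IsPosAffiliated M a) {r : ℝ} (hr : 0 < r) (x : a.domain) :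
    (approx M a r : H →L[ℂ] H) ((r : ℂ) • (x : H) + a x) = (r : ℂ) • a x := by
  have h := (ha.existsUnique_approx hr).exists
  rw [approx, dif_pos h]
  exact h.choose_spec x

/-- The net `a_r` is increasing in `r > 0`. -/
theorem IsPosAffiliated.approx_mono {M : VonNeumannAlgebra H} {a : H →ₗ.[ℂ] H}
    (ha : IsPosAffiliated M a) {r s : ℝ} (hr : 0 < r) (hrs : r ≤ s) :
    ((approx M a s - approx M a r : M.toStarSubalgebra) : H →L[ℂ] H).IsPositive := by
  have hs : 0 < s := hr.trans_le hrs
  have hdense : Dense (a.domain : Set H) := ha.selfAdjoint.dense_domain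
  have hadj : a.adjoint = a := LinearPMap.isSelfAdjoint_def.mp ha.selfAdjoint
  have hsymm : ∀ x y : a.domain, ⟪a x, (y : H)⟫_ℂ = ⟪(x : H), a y⟫_ℂ := by
    have h := LinearPMap.adjoint_isFormalAdjoint hdense
    rw [hadj] at h
    exact h
  rw [ContinuousLinearMap.isPositive_iff_complex]
  intro z
  obtain ⟨x, rfl⟩ := ha.shift_surjective hr z
  obtain ⟨w, hw⟩ := ha.shift_surjective hs (x : H)
  rw [shift_apply] at hw
  let t : a.domain := x - (s : ℂ) • w
  have ht : (t : H) = a w := by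
    change (x : H) - (s : ℂ) • (w : H) = a w
    rw [← hw]
    abel
  have hx : x = t + (s : ℂ) • w := by simp [t]
  let y : a.domain := x - ((s - r : ℝ) : ℂ) • w
  have hax : a x = a t + (s : ℂ) • (t : H) := by
    rw [hx, LinearPMap.map_add, LinearPMap.map_smul, ht]
  have hay : a y = a x - ((s - r : ℝ) : ℂ) • (t : H) := by
    rw [LinearPMap.map_sub, LinearPMap.map_smul, ht]
  have hy : shift a r x = (s : ℂ) • (y : H) + a y := by
    have h1 : (y : H) = x - ((s - r : ℝ) : ℂ) • (w : H) := rfl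
    have h2 : (x : H) = t + (s : ℂ) • (w : H) := congrArg Subtype.val hx
    rw [shift_apply, hay, h1, h2]
    push_cast
    module
  have e1 : (approx M a s : H →L[ℂ] H) (shift a r x) = (s : ℂ) • a y := by
    rw [hy, ha.approx_apply hs]
  have e2 : (approx M a r : H →L[ℂ] H) (shift a r x) = (r : ℂ) • a x := ha.approx_apply hr x
  have e3 : ((approx M a s - approx M a r : M.toStarSubalgebra) : H →L[ℂ] H) (shift a r x)
      = ((s - r : ℝ) : ℂ) • a t := by
    change (approx M a s : H →L[ℂ] H) (shift a r x) - (approx M a r : H →L[ℂ] H) (shift a r x) = _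
    rw [e1, e2, hay, hax]
    push_cast
    module
  have hreal : ∀ v : a.domain, ⟪a v, (v : H)⟫_ℂ = (((⟪a v, (v : H)⟫_ℂ).re : ℝ) : ℂ) := by
    intro v
    refine (Complex.conj_eq_iff_re.mp ?_).symm
    rw [inner_conj_symm, hsymm]
  have hsq : ∀ v : H, ⟪v, v⟫_ℂ = ((‖v‖ ^ 2 : ℝ) : ℂ) := by
    intro v
    simp
  have e4 : ⟪a t, shift a r x⟫_ℂ =
      ((r * s * ‖t‖ ^ 2 + (r + s) * (⟪a t, (t : H)⟫_ℂ).re + ‖a t‖ ^ 2 : ℝ) : ℂ) := by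
    have h2 : (x : H) = t + (s : ℂ) • (w : H) := congrArg Subtype.val hx
    have h3 : ⟪a t, (w : H)⟫_ℂ = ((‖t‖ ^ 2 : ℝ) : ℂ) := by
      rw [hsymm, ← ht, hsq]
      rfl
    rw [shift_apply, hax, h2]
    simp only [inner_add_right, inner_smul_right, h3, hsq (a t)]
    rw [hreal t]
    push_cast
    simp only [Complex.ofReal_re]
    ring
  have e5 : 0 ≤ (s - r) * (r * s * ‖t‖ ^ 2 + (r + s) * (⟪a t, (t : H)⟫_ℂ).re + ‖a t‖ ^ 2) := by
    have h1 := ha.nonneg t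
    have h2 : 0 ≤ s - r := sub_nonneg.mpr hrs
    positivity
  rw [e3, inner_smul_left, Complex.conj_ofReal, e4, ← Complex.ofReal_mul]
  exact ⟨rfl, e5⟩

/-- The predual of `M`: the linear functionals `∑ₙ ⟨· fₙ, gₙ⟩` on `M` with `∑ₙ ‖fₙ‖² < ∞` and
`∑ₙ ‖gₙ‖² < ∞` (the σ-weakly continuous functionals). -/
def predual (M : VonNeumannAlgebra H) : Submodule ℂ (M.toStarSubalgebra →ₗ[ℂ] ℂ) where
  carrier := {φ | ∃ f g : ℕ → H, Summable (fun n => ‖f n‖ ^ 2) ∧ Summable (fun n => ‖g n‖ ^ 2) ∧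
    ∀ x : M.toStarSubalgebra, HasSum (fun n => ⟪g n, (x : H →L[ℂ] H) (f n)⟫_ℂ) (φ x)}
  zero_mem' := ⟨0, 0, by simp, by simp, fun x => by simp⟩
  add_mem' := by
    rintro φ ψ ⟨f, g, hf, hg, h⟩ ⟨f', g', hf', hg', h'⟩
    have e := Equiv.natSumNatEquivNat
    refine ⟨Sum.elim f f' ∘ e.symm, Sum.elim g g' ∘ e.symm, ?_, ?_, fun x => ?_⟩
    · exact (e.symm.summable_iff (f := fun i => ‖Sum.elim f f' i‖ ^ 2)).mpr
        (Summable.sum (fun i => ‖Sum.elim f f' i‖ ^ 2) hf hf')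
    · exact (e.symm.summable_iff (f := fun i => ‖Sum.elim g g' i‖ ^ 2)).mpr
        (Summable.sum (fun i => ‖Sum.elim g g' i‖ ^ 2) hg hg')
    · exact (e.symm.hasSum_iff
        (f := fun i => ⟪Sum.elim g g' i, (x : H →L[ℂ] H) (Sum.elim f f' i)⟫_ℂ)).mpr
        (HasSum.sum (h x) (h' x))
  smul_mem' := by
    rintro c φ ⟨f, g, hf, hg, h⟩
    refine ⟨fun n => c • f n, g, ?_, hg, fun x => ?_⟩
    · simpa only [norm_smul, mul_pow] using hf.mul_left (‖c‖ ^ 2)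
    · simpa only [map_smul, inner_smul_right, LinearMap.smul_apply, smul_eq_mul]
        using (h x).mul_left c

/-- The positive part of the predual: the `φ` in the predual with `φ x ≥ 0` for every positive
operator `x` in `M`. -/
def predualPos (M : VonNeumannAlgebra H) : Set (M.toStarSubalgebra →ₗ[ℂ] ℂ) :=
  {φ | φ ∈ predual M ∧ ∀ x : M.toStarSubalgebra, (x : H →L[ℂ] H).IsPositive →
    0 ≤ (φ x).re ∧ (φ x).im = 0}

/-- The value `φ(a) = lim_{r → ∞} φ(a_r) ∈ [0, ∞]` for positive `φ`. The net `a_r` is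
increasing, so the limit exists and agrees with the upper limit taken here; see
`IsPosAffiliated.tendsto_value`. -/
def value (M : VonNeumannAlgebra H) (a : H →ₗ.[ℂ] H) (φ : M.toStarSubalgebra →ₗ[ℂ] ℂ) : ENNReal :=
  Filter.limsup (fun r : ℝ => ENNReal.ofReal (φ (approx M a r)).re) Filter.atTop

theorem IsPosAffiliated.tendsto_value {M : VonNeumannAlgebra H} {a : H →ₗ.[ℂ] H}
    (ha : IsPosAffiliated M a) {φ : M.toStarSubalgebra →ₗ[ℂ] ℂ} (hφ : φ ∈ predualPos M) :
    Filter.Tendsto (fun r : ℝ => ENNReal.ofReal (φ (approx M a r)).re) Filter.atTop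
      (nhds (value M a φ)) := by
  have hmono : Monotone fun r : ℝ => ENNReal.ofReal (φ (approx M a (max r 1))).re := by
    intro r s hrs
    apply ENNReal.ofReal_le_ofReal
    have h := (hφ.2 _ (ha.approx_mono (lt_of_lt_of_le one_pos (le_max_right r 1))
      (max_le_max_right 1 hrs))).1
    rw [map_sub, Complex.sub_re] at h
    linarith
  have h := (tendsto_atTop_iSup hmono).congr' (by
    filter_upwards [Filter.eventually_ge_atTop (1 : ℝ)] with r hr
    rw [max_eq_left hr] : _ =ᶠ[Filter.atTop] fun r : ℝ => ENNReal.ofReal (φ (approx M a r)).re)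
  rwa [value, h.limsup_eq]

/-- The cone `𝔇_a⁺` of all positive `φ` in the predual with `φ(a) < ∞`. -/
def DPos (M : VonNeumannAlgebra H) (a : H →ₗ.[ℂ] H) : Set (M.toStarSubalgebra →ₗ[ℂ] ℂ) :=
  {φ | φ ∈ predualPos M ∧ value M a φ < ⊤}

section

variable {M : VonNeumannAlgebra H} {a : H →ₗ.[ℂ] H}

theorem value_zero : value M a 0 = 0 := by
  simp [value]

theorem value_add_le (φ ψ : M.toStarSubalgebra →ₗ[ℂ] ℂ) :
    value M a (φ + ψ) ≤ value M a φ + value M a ψ := by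
  refine ENNReal.le_of_forall_pos_le_add fun ε hε hlt => ?_
  have hε' : (0 : ENNReal) < (ε : ENNReal) / 2 := by
    simpa using hε.ne'
  have hA := (ENNReal.add_lt_top.mp hlt).1
  have hB := (ENNReal.add_lt_top.mp hlt).2
  have h1 := Filter.eventually_lt_of_limsup_lt (ENNReal.lt_add_right hA.ne hε'.ne')
  have h2 := Filter.eventually_lt_of_limsup_lt (ENNReal.lt_add_right hB.ne hε'.ne')
  refine Filter.limsup_le_of_le (by isBoundedDefault) ?_
  filter_upwards [h1, h2] with r h1 h2
  rw [LinearMap.add_apply, Complex.add_re]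
  calc _ ≤ _ := ENNReal.ofReal_add_le
    _ ≤ _ := add_le_add h1.le h2.le
    _ = value M a φ + value M a ψ + ((ε : ENNReal) / 2 + (ε : ENNReal) / 2) := by
      rw [value, value]
      ring
    _ = _ := by rw [ENNReal.add_halves]

theorem value_smul {c : ℝ} (hc : 0 ≤ c) (φ : M.toStarSubalgebra →ₗ[ℂ] ℂ) :
    value M a (c • φ) = ENNReal.ofReal c * value M a φ := by
  rw [value, value, ← ENNReal.limsup_const_mul_of_ne_top ENNReal.ofReal_ne_top]
  congr 1
  ext r
  rw [LinearMap.smul_apply, Complex.smul_re, smul_eq_mul, ENNReal.ofReal_mul hc]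

theorem zero_mem_DPos : (0 : M.toStarSubalgebra →ₗ[ℂ] ℂ) ∈ DPos M a :=
  ⟨⟨zero_mem _, fun x _ => by simp⟩, by simp [value_zero]⟩

theorem add_mem_DPos {φ ψ : M.toStarSubalgebra →ₗ[ℂ] ℂ} (hφ : φ ∈ DPos M a)
    (hψ : ψ ∈ DPos M a) : φ + ψ ∈ DPos M a := by
  refine ⟨⟨add_mem hφ.1.1 hψ.1.1, fun x hx => ?_⟩,
    (value_add_le φ ψ).trans_lt (ENNReal.add_lt_top.mpr ⟨hφ.2, hψ.2⟩)⟩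
  have h1 := hφ.1.2 x hx
  have h2 := hψ.1.2 x hx
  rw [LinearMap.add_apply, Complex.add_re, Complex.add_im, h1.2, h2.2]
  exact ⟨add_nonneg h1.1 h2.1, add_zero 0⟩

theorem smul_mem_DPos {c : ℝ} (hc : 0 ≤ c) {φ : M.toStarSubalgebra →ₗ[ℂ] ℂ}
    (hφ : φ ∈ DPos M a) : c • φ ∈ DPos M a := by
  refine ⟨⟨?_, fun x hx => ?_⟩, ?_⟩
  · have : c • φ = (c : ℂ) • φ := by ext x; simp
    rw [this]
    exact (predual M).smul_mem _ hφ.1.1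
  · have h := hφ.1.2 x hx
    rw [LinearMap.smul_apply, Complex.smul_re, Complex.smul_im, h.2]
    exact ⟨mul_nonneg hc h.1, smul_zero c⟩
  · rw [value_smul hc]
    exact ENNReal.mul_lt_top ENNReal.ofReal_lt_top hφ.2

end

/-- The real vector space `𝔇_aʰ = 𝔇_a⁺ - 𝔇_a⁺`. -/
def DHerm (M : VonNeumannAlgebra H) (a : H →ₗ.[ℂ] H) :
    Submodule ℝ (M.toStarSubalgebra →ₗ[ℂ] ℂ) where
  carrier := {φ | ∃ φ₁ ∈ DPos M a, ∃ φ₂ ∈ DPos M a, φ = φ₁ - φ₂}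
  zero_mem' := ⟨0, zero_mem_DPos, 0, zero_mem_DPos, (sub_zero 0).symm⟩
  add_mem' := by
    rintro _ _ ⟨φ₁, h₁, φ₂, h₂, rfl⟩ ⟨ψ₁, k₁, ψ₂, k₂, rfl⟩
    exact ⟨_, add_mem_DPos h₁ k₁, _, add_mem_DPos h₂ k₂, by abel⟩
  smul_mem' := by
    rintro c _ ⟨φ₁, h₁, φ₂, h₂, rfl⟩
    rcases le_total 0 c with hc | hc
    · exact ⟨_, smul_mem_DPos hc h₁, _, smul_mem_DPos hc h₂, smul_sub _ _ _⟩
    · have hc' : 0 ≤ -c := neg_nonneg.mpr hc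
      refine ⟨_, smul_mem_DPos hc' h₂, _, smul_mem_DPos hc' h₁, ?_⟩
      simp only [neg_smul, smul_sub]
      abel

/-- The set of all `φ₁(a) + φ₂(a)` where `φ = φ₁ - φ₂` and `φ₁, φ₂ ∈ 𝔇_a⁺`. -/
def normSet (M : VonNeumannAlgebra H) (a : H →ₗ.[ℂ] H) (φ : M.toStarSubalgebra →ₗ[ℂ] ℂ) : Set ℝ :=
  {t | ∃ φ₁ ∈ DPos M a, ∃ φ₂ ∈ DPos M a, φ = φ₁ - φ₂ ∧
    t = (value M a φ₁).toReal + (value M a φ₂).toReal}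

section

variable {M : VonNeumannAlgebra H} {a : H →ₗ.[ℂ] H}

theorem normSet_nonneg {φ : M.toStarSubalgebra →ₗ[ℂ] ℂ} {t : ℝ} (ht : t ∈ normSet M a φ) :
    0 ≤ t := by
  obtain ⟨φ₁, _, φ₂, _, _, rfl⟩ := ht
  exact add_nonneg ENNReal.toReal_nonneg ENNReal.toReal_nonneg

theorem normSet_bddBelow (φ : M.toStarSubalgebra →ₗ[ℂ] ℂ) : BddBelow (normSet M a φ) :=
  ⟨0, fun _ ht => normSet_nonneg ht⟩

theorem normSet_nonempty {φ : M.toStarSubalgebra →ₗ[ℂ] ℂ} (hφ : φ ∈ DHerm M a) :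
    (normSet M a φ).Nonempty := by
  obtain ⟨φ₁, h₁, φ₂, h₂, h⟩ := hφ
  exact ⟨_, φ₁, h₁, φ₂, h₂, h, rfl⟩

theorem exists_normSet_add_le {φ ψ : M.toStarSubalgebra →ₗ[ℂ] ℂ} {s t : ℝ}
    (hs : s ∈ normSet M a φ) (ht : t ∈ normSet M a ψ) : ∃ u ∈ normSet M a (φ + ψ), u ≤ s + t := by
  obtain ⟨φ₁, h₁, φ₂, h₂, rfl, rfl⟩ := hs
  obtain ⟨ψ₁, k₁, ψ₂, k₂, rfl, rfl⟩ := ht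
  refine ⟨_, ⟨_, add_mem_DPos h₁ k₁, _, add_mem_DPos h₂ k₂, by abel, rfl⟩, ?_⟩
  have e₁ := ENNReal.toReal_mono (ENNReal.add_lt_top.mpr ⟨h₁.2, k₁.2⟩).ne (value_add_le φ₁ ψ₁)
  have e₂ := ENNReal.toReal_mono (ENNReal.add_lt_top.mpr ⟨h₂.2, k₂.2⟩).ne (value_add_le φ₂ ψ₂)
  rw [ENNReal.toReal_add h₁.2.ne k₁.2.ne] at e₁
  rw [ENNReal.toReal_add h₂.2.ne k₂.2.ne] at e₂
  linarith

theorem smul_mem_normSet (c : ℝ) {φ : M.toStarSubalgebra →ₗ[ℂ] ℂ} {t : ℝ}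
    (ht : t ∈ normSet M a φ) : |c| * t ∈ normSet M a (c • φ) := by
  obtain ⟨φ₁, h₁, φ₂, h₂, rfl, rfl⟩ := ht
  have hv : ∀ θ : M.toStarSubalgebra →ₗ[ℂ] ℂ,
      (value M a (|c| • θ)).toReal = |c| * (value M a θ).toReal := fun θ => by
    rw [value_smul (abs_nonneg c), ENNReal.toReal_mul, ENNReal.toReal_ofReal (abs_nonneg c)]
  rcases le_total 0 c with hc | hc
  · refine ⟨_, smul_mem_DPos (abs_nonneg c) h₁, _, smul_mem_DPos (abs_nonneg c) h₂, ?_, ?_⟩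
    · rw [abs_of_nonneg hc, smul_sub]
    · rw [hv, hv, mul_add]
  · refine ⟨_, smul_mem_DPos (abs_nonneg c) h₂, _, smul_mem_DPos (abs_nonneg c) h₁, ?_, ?_⟩
    · simp only [abs_of_nonpos hc, neg_smul, smul_sub]
      abel
    · rw [hv, hv, mul_add, add_comm]

end

/-- The seminorm `‖φ‖_a = inf {φ₁(a) + φ₂(a) | φ = φ₁ - φ₂, φ₁, φ₂ ∈ 𝔇_a⁺}` on `𝔇_aʰ`. -/
def seminormA (M : VonNeumannAlgebra H) (a : H →ₗ.[ℂ] H) : Seminorm ℝ (DHerm M a) :=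
  Seminorm.ofSMulLE (fun φ => sInf (normSet M a (φ : M.toStarSubalgebra →ₗ[ℂ] ℂ)))
    (by
      refine le_antisymm (csInf_le (normSet_bddBelow _) ?_)
        (le_csInf (normSet_nonempty (zero_mem _)) fun _ ht => normSet_nonneg ht)
      exact ⟨0, zero_mem_DPos, 0, zero_mem_DPos, by simp, by simp [value_zero]⟩)
    (by
      intro φ ψ
      refine le_of_forall_pos_le_add fun ε hε => ?_
      obtain ⟨s, hs, hs'⟩ := exists_lt_of_csInf_lt (normSet_nonempty φ.2)
        (lt_add_of_pos_right (sInf (normSet M a φ)) (half_pos hε))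
      obtain ⟨t, ht, ht'⟩ := exists_lt_of_csInf_lt (normSet_nonempty ψ.2)
        (lt_add_of_pos_right (sInf (normSet M a ψ)) (half_pos hε))
      obtain ⟨u, hu, hu'⟩ := exists_normSet_add_le hs ht
      have := csInf_le (normSet_bddBelow _) hu
      rw [Submodule.coe_add]
      linarith)
    (by
      intro c φ
      refine le_of_forall_pos_le_add fun ε hε => ?_
      have hc : 0 < |c| + 1 := by positivity
      obtain ⟨t, ht, ht'⟩ := exists_lt_of_csInf_lt (normSet_nonempty φ.2)
        (lt_add_of_pos_right (sInf (normSet M a φ)) (div_pos hε hc))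
      have h := csInf_le (normSet_bddBelow _) (smul_mem_normSet c ht)
      have h2 : |c| * (ε / (|c| + 1)) ≤ ε := by
        rw [mul_div_assoc', div_le_iff₀ hc]
        nlinarith [abs_nonneg c]
      have h3 := mul_le_mul_of_nonneg_left ht'.le (abs_nonneg c)
      rw [mul_add] at h3
      rw [Submodule.coe_smul, Real.norm_eq_abs]
      linarith)

theorem seminormA_apply (M : VonNeumannAlgebra H) (a : H →ₗ.[ℂ] H) (φ : DHerm M a) :
    seminormA M a φ = sInf (normSet M a (φ : M.toStarSubalgebra →ₗ[ℂ] ℂ)) := rfl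

/-- A seminorm is a norm if it vanishes only at `0`. -/
def IsNorm {E : Type*} [AddCommGroup E] [Module ℝ E] (p : Seminorm ℝ E) : Prop :=
  ∀ φ : E, p φ = 0 → φ = 0

end OperatorL1

end

open scoped InnerProductSpace

namespace OperatorL1

variable {H : Type*} [NormedAddCommGroup H] [InnerProductSpace ℂ H] [CompleteSpace H]
variable {M : VonNeumannAlgebra H} {a : H →ₗ.[ℂ] H}

/-! Suppose `a` is injective and `‖φ‖_a = 0`. Spectrally `a_r ≤ r`, so `a_r² ≤ r a_r`, and for `0 ≤
z ≤ k` in `M` this gives `0 ≤ a_r z a_r ≤ k a_r² ≤ k r a_r` (`approx_conj_le`). A positive `ψ` with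
`ψ(a) < ∞` thus satisfies `|ψ(a_r z a_r)| ≤ k r ψ(a)`. Applied to both parts of a decomposition of
`φ`, and with the infimum taken over decompositions, this yields `φ(a_r z a_r) = 0`, first for
positive `z` and by linearity for all `z` in `M` (`conj_eq_zero`).

To remove the factors `a_r`, let `r → 0` rather than `r → ∞`: the contractions `r⁻¹ a_r = a (r +
a)⁻¹` converge strongly to the projection onto the closure of the range of `a`, which is `1` because
a selfadjoint injective operator has dense range (`tendsto_contr`). Normality of `φ` lets the limit
pass inside (`tendsto_conj_contr`), so `φ(z) = 0`.

Conversely, if `a x = 0`, the vector functional of `x` takes the value `0` at `a`, so its seminorm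
vanishes. If the seminorm is a norm, the functional is `0`, and its value `‖x‖²` at `1` forces `x =
0`. -/

/-! ### Positivity and norm bounds for the approximants. -/

theorem IsPosAffiliated.inner_symm (ha : IsPosAffiliated M a) (x y : a.domain) :
    ⟪a x, (y : H)⟫_ℂ = ⟪(x : H), a y⟫_ℂ := by
  have h := LinearPMap.adjoint_isFormalAdjoint ha.selfAdjoint.dense_domain
  rw [LinearPMap.isSelfAdjoint_def.mp ha.selfAdjoint] at h
  exact h x y

theorem IsPosAffiliated.inner_eq_re (ha : IsPosAffiliated M a) (x : a.domain) :
    ⟪a x, (x : H)⟫_ℂ = ((⟪a x, (x : H)⟫_ℂ).re : ℂ) := by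
  refine (Complex.conj_eq_iff_re.mp ?_).symm
  rw [inner_conj_symm, ha.inner_symm]

theorem IsPosAffiliated.approx_shift (ha : IsPosAffiliated M a) {r : ℝ} (hr : 0 < r)
    (x : a.domain) : (approx M a r : H →L[ℂ] H) (shift a r x) = (r : ℂ) • a x :=
  ha.approx_apply hr x

theorem IsPosAffiliated.inner_approx_shift (ha : IsPosAffiliated M a) {r : ℝ} (hr : 0 < r)
    (x : a.domain) :
    ⟪(approx M a r : H →L[ℂ] H) (shift a r x), shift a r x⟫_ℂ =
      ((r * (r * (⟪a x, (x : H)⟫_ℂ).re + ‖a x‖ ^ 2) : ℝ) : ℂ) := by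
  rw [ha.approx_shift hr, shift_apply, inner_smul_left, Complex.conj_ofReal, inner_add_right,
    inner_smul_right, ha.inner_eq_re, inner_self_eq_norm_sq_to_K]
  push_cast
  simp

theorem IsPosAffiliated.approx_isPositive (ha : IsPosAffiliated M a) {r : ℝ} (hr : 0 < r) :
    (approx M a r : H →L[ℂ] H).IsPositive := by
  rw [ContinuousLinearMap.isPositive_iff_complex]
  intro z
  obtain ⟨x, rfl⟩ := ha.shift_surjective hr z
  rw [ha.inner_approx_shift hr]
  have := ha.nonneg x
  refine ⟨rfl, ?_⟩
  rw [RCLike.re_to_complex, Complex.ofReal_re]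
  positivity

/-- This is `a_r² ≤ r a_r` as quadratic forms. For `z = (r + a) x` the two sides differ by `r³ ⟪a x,
x⟫ ≥ 0`, so no functional calculus is needed. -/
theorem IsPosAffiliated.norm_approx_apply_sq_le (ha : IsPosAffiliated M a) {r : ℝ} (hr : 0 < r)
    (z : H) : ‖(approx M a r : H →L[ℂ] H) z‖ ^ 2 ≤
      r * (⟪(approx M a r : H →L[ℂ] H) z, z⟫_ℂ).re := by
  obtain ⟨x, rfl⟩ := ha.shift_surjective hr z
  rw [ha.inner_approx_shift hr, ha.approx_shift hr, Complex.ofReal_re, norm_smul,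
    Complex.norm_real, Real.norm_of_nonneg hr.le]
  have : 0 ≤ r * (r * (r * (⟪a x, (x : H)⟫_ℂ).re)) := by
    have := ha.nonneg x
    positivity
  linarith

theorem IsPosAffiliated.norm_approx_apply_le (ha : IsPosAffiliated M a) {r : ℝ} (hr : 0 < r)
    (z : H) : ‖(approx M a r : H →L[ℂ] H) z‖ ≤ r * ‖z‖ := by
  have h1 := ha.norm_approx_apply_sq_le hr z
  have h2 : (⟪(approx M a r : H →L[ℂ] H) z, z⟫_ℂ).re ≤ _ := re_inner_le_norm (𝕜 := ℂ) _ _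
  have h3 := mul_le_mul_of_nonneg_left h2 hr.le
  rcases (norm_nonneg ((approx M a r : H →L[ℂ] H) z)).eq_or_lt with h | h
  · rw [← h]
    positivity
  · refine le_of_mul_le_mul_right ?_ h
    linarith

/-! ### Functionals of zero seminorm vanish on `a_r M a_r`. -/

/-- If `0 ≤ z ≤ k` then `a_r z a_r ≤ k r a_r`. -/
theorem IsPosAffiliated.approx_conj_le (ha : IsPosAffiliated M a) {r : ℝ} (hr : 0 < r)
    {k : ℝ} (hk : 0 ≤ k) (z : M.toStarSubalgebra)
    (hz : (z : H →L[ℂ] H).IsPositive)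
    (hzk : ∀ y, (⟪(z : H →L[ℂ] H) y, y⟫_ℂ).re ≤ k * ‖y‖ ^ 2) :
    ((approx M a r * z * approx M a r : M.toStarSubalgebra) : H →L[ℂ] H).IsPositive ∧
    (((k * r : ℝ) : ℂ) • approx M a r - approx M a r * z * approx M a r :
      M.toStarSubalgebra).1.IsPositive := by
  have hb := ha.approx_isPositive hr
  have hconj : ∀ y, ⟪((approx M a r * z * approx M a r : M.toStarSubalgebra) : H →L[ℂ] H) y, y⟫_ℂ
      = ⟪(z : H →L[ℂ] H) ((approx M a r : H →L[ℂ] H) y), (approx M a r : H →L[ℂ] H) y⟫_ℂ :=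
    fun y => hb.inner_left_eq_inner_right _ _
  have hreal : ∀ {T : H →L[ℂ] H}, T.IsPositive → ∀ y, ⟪T y, y⟫_ℂ = ((⟪T y, y⟫_ℂ).re : ℂ) :=
    fun hT y => ((ContinuousLinearMap.isPositive_iff_complex _).mp hT y).1.symm
  have hnonneg : ∀ {T : H →L[ℂ] H}, T.IsPositive → ∀ y, 0 ≤ (⟪T y, y⟫_ℂ).re :=
    fun hT y => ((ContinuousLinearMap.isPositive_iff_complex _).mp hT y).2
  refine ⟨?_, ?_⟩
  · rw [ContinuousLinearMap.isPositive_iff_complex]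
    intro y
    rw [hconj]
    exact ⟨(hreal hz _).symm, hnonneg hz _⟩
  · rw [ContinuousLinearMap.isPositive_iff_complex]
    intro y
    have h : ⟪(((k * r : ℝ) : ℂ) • approx M a r - approx M a r * z * approx M a r :
        M.toStarSubalgebra).1 y, y⟫_ℂ =
        ((k * r * (⟪(approx M a r : H →L[ℂ] H) y, y⟫_ℂ).re -
          (⟪(z : H →L[ℂ] H) ((approx M a r : H →L[ℂ] H) y),
            (approx M a r : H →L[ℂ] H) y⟫_ℂ).re : ℝ) : ℂ) := by
      change ⟪((k * r : ℝ) : ℂ) • (approx M a r : H →L[ℂ] H) y -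
        ((approx M a r * z * approx M a r : M.toStarSubalgebra) : H →L[ℂ] H) y, y⟫_ℂ = _
      rw [inner_sub_left, hconj, inner_smul_left, Complex.conj_ofReal, hreal hb, hreal hz]
      push_cast
      simp only [Complex.ofReal_re]
    rw [h]
    refine ⟨rfl, ?_⟩
    rw [RCLike.re_to_complex, Complex.ofReal_re]
    -- Use `z ≤ k` at the vector `a_r y`, then `k a_r² ≤ k r a_r`.
    have h1 := hzk ((approx M a r : H →L[ℂ] H) y)
    have h2 := mul_le_mul_of_nonneg_left (ha.norm_approx_apply_sq_le hr y) hk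
    linarith

theorem IsPosAffiliated.re_approx_le_value (ha : IsPosAffiliated M a)
    {φ : M.toStarSubalgebra →ₗ[ℂ] ℂ} (hφ : φ ∈ DPos M a) {r : ℝ} (hr : 0 < r) :
    (φ (approx M a r)).re ≤ (value M a φ).toReal := by
  rw [← ENNReal.ofReal_le_iff_le_toReal hφ.2.ne]
  refine ge_of_tendsto (ha.tendsto_value hφ.1) ?_
  filter_upwards [Filter.eventually_ge_atTop r] with s hs
  refine ENNReal.ofReal_le_ofReal ?_
  have h := (hφ.1.2 _ (ha.approx_mono hr hs)).1
  rw [map_sub, Complex.sub_re] at h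
  linarith

/-- Positivity of `φ` turns the operator inequality `a_r z a_r ≤ k r a_r` into a numerical one, and
`φ(a_r) ≤ φ(a)` since the net increases. -/
theorem IsPosAffiliated.norm_conj_le_value (ha : IsPosAffiliated M a)
    {φ : M.toStarSubalgebra →ₗ[ℂ] ℂ} (hφ : φ ∈ DPos M a) {r : ℝ} (hr : 0 < r)
    {k : ℝ} (hk : 0 ≤ k) (z : M.toStarSubalgebra)
    (hz : (z : H →L[ℂ] H).IsPositive)
    (hzk : ∀ y, (⟪(z : H →L[ℂ] H) y, y⟫_ℂ).re ≤ k * ‖y‖ ^ 2) :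
    ‖φ (approx M a r * z * approx M a r)‖ ≤ k * r * (value M a φ).toReal := by
  obtain ⟨h1, h2⟩ := ha.approx_conj_le hr hk z hz hzk
  obtain ⟨h3, h4⟩ := hφ.1.2 _ h1
  have h5 := (hφ.1.2 _ h2).1
  rw [map_sub, map_smul, smul_eq_mul, Complex.sub_re, Complex.re_ofReal_mul] at h5
  have h6 := mul_le_mul_of_nonneg_left (ha.re_approx_le_value hφ hr) (mul_nonneg hk hr.le)
  have h7 : φ (approx M a r * z * approx M a r) =
      ((φ (approx M a r * z * approx M a r)).re : ℂ) := Complex.ext rfl h4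
  rw [h7, Complex.norm_real, Real.norm_of_nonneg h3]
  linarith

theorem IsPosAffiliated.conj_eq_zero_of_isPositive (ha : IsPosAffiliated M a)
    {φ : M.toStarSubalgebra →ₗ[ℂ] ℂ} (hφ : φ ∈ DHerm M a) (h0 : sInf (normSet M a φ) = 0)
    {r : ℝ} (hr : 0 < r) (z : M.toStarSubalgebra) (hz : (z : H →L[ℂ] H).IsPositive) :
    φ (approx M a r * z * approx M a r) = 0 := by
  have hzk : ∀ y, (⟪(z : H →L[ℂ] H) y, y⟫_ℂ).re ≤ ‖(z : H →L[ℂ] H)‖ * ‖y‖ ^ 2 := by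
    intro y
    have h1 : (⟪(z : H →L[ℂ] H) y, y⟫_ℂ).re ≤ _ := re_inner_le_norm (𝕜 := ℂ) _ _
    have h2 := mul_le_mul_of_nonneg_right ((z : H →L[ℂ] H).le_opNorm y) (norm_nonneg y)
    linarith
  set C := ‖(z : H →L[ℂ] H)‖ * r
  have hC : 0 ≤ C := by positivity
  have hle : ∀ t ∈ normSet M a φ, ‖φ (approx M a r * z * approx M a r)‖ ≤ C * t := by
    rintro t ⟨φ₁, h₁, φ₂, h₂, rfl, rfl⟩
    rw [LinearMap.sub_apply, mul_add]
    exact (norm_sub_le _ _).trans (add_le_add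
      (ha.norm_conj_le_value h₁ hr (norm_nonneg _) z hz hzk)
      (ha.norm_conj_le_value h₂ hr (norm_nonneg _) z hz hzk))
  rw [← norm_le_zero_iff]
  refine le_of_forall_pos_le_add fun ε hε => ?_
  obtain ⟨t, ht, ht'⟩ := exists_lt_of_csInf_lt (normSet_nonempty hφ)
    -- The `+ 1` keeps the denominator positive when `C = 0`.
    (show sInf (normSet M a φ) < ε / (C + 1) by rw [h0]; positivity)
  have h1 : C * t ≤ C * (ε / (C + 1)) := mul_le_mul_of_nonneg_left ht'.le hC
  have h2 : C * (ε / (C + 1)) ≤ ε := by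
    rw [mul_div_assoc', div_le_iff₀ (by positivity)]
    nlinarith
  linarith [hle t ht]

/-- Writes a selfadjoint element as a positive one minus a multiple of `1`, which stays in `M`
without any appeal to positive and negative parts. -/
theorem isPositive_norm_add {z : H →L[ℂ] H} (hz : IsSelfAdjoint z) :
    ((‖z‖ : ℂ) • (1 : H →L[ℂ] H) + z).IsPositive := by
  rw [ContinuousLinearMap.isPositive_def']
  refine ⟨?_, fun y => ?_⟩
  · refine IsSelfAdjoint.add ?_ hz
    exact IsSelfAdjoint.smul (Complex.conj_ofReal _) (IsSelfAdjoint.one _)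
  · have h1 : -(⟪z y, y⟫_ℂ).re ≤ ‖z‖ * ‖y‖ ^ 2 := by
      have h1 := (abs_le.mp (Complex.abs_re_le_norm (⟪z y, y⟫_ℂ))).1
      have h2 := norm_inner_le_norm (𝕜 := ℂ) (z y) y
      have h3 := mul_le_mul_of_nonneg_right (z.le_opNorm y) (norm_nonneg y)
      linarith
    have h2 : (⟪y, y⟫_ℂ).re = ‖y‖ ^ 2 := inner_self_eq_norm_sq (𝕜 := ℂ) y
    change 0 ≤ (⟪(‖z‖ : ℂ) • y + z y, y⟫_ℂ).re
    rw [inner_add_left, inner_smul_left, Complex.conj_ofReal, Complex.add_re,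
      Complex.re_ofReal_mul, h2]
    linarith

theorem IsPosAffiliated.conj_eq_zero_of_isSelfAdjoint (ha : IsPosAffiliated M a)
    {φ : M.toStarSubalgebra →ₗ[ℂ] ℂ} (hφ : φ ∈ DHerm M a) (h0 : sInf (normSet M a φ) = 0)
    {r : ℝ} (hr : 0 < r) (z : M.toStarSubalgebra) (hz : IsSelfAdjoint z) :
    φ (approx M a r * z * approx M a r) = 0 := by
  have hz' : IsSelfAdjoint (z : H →L[ℂ] H) := congrArg Subtype.val hz
  have h1 := ha.conj_eq_zero_of_isPositive hφ h0 hr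
    ((‖(z : H →L[ℂ] H)‖ : ℂ) • 1 + z) (isPositive_norm_add hz')
  have h2 := ha.conj_eq_zero_of_isPositive hφ h0 hr 1 ContinuousLinearMap.isPositive_one
  rwa [mul_add, add_mul, map_add, mul_smul_comm, smul_mul_assoc, map_smul, h2, smul_zero,
    zero_add] at h1

theorem IsPosAffiliated.conj_eq_zero (ha : IsPosAffiliated M a)
    {φ : M.toStarSubalgebra →ₗ[ℂ] ℂ} (hφ : φ ∈ DHerm M a) (h0 : sInf (normSet M a φ) = 0)
    {r : ℝ} (hr : 0 < r) (z : M.toStarSubalgebra) :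
    φ (approx M a r * z * approx M a r) = 0 := by
  rw [← realPart_add_I_smul_imaginaryPart z, mul_add, add_mul, map_add, mul_smul_comm,
    smul_mul_assoc, map_smul,
    ha.conj_eq_zero_of_isSelfAdjoint hφ h0 hr _ (realPart z).2,
    ha.conj_eq_zero_of_isSelfAdjoint hφ h0 hr _ (imaginaryPart z).2, smul_zero, add_zero]

/-! ### Strong convergence of `a (r + a)⁻¹` to `1` as `r → 0`. -/

/-- A vector `w` orthogonal to the range lies in the domain of the adjoint, which is `a` itself,
with `a w = 0`; injectivity gives `w = 0`. -/
theorem IsPosAffiliated.dense_range (ha : IsPosAffiliated M a) (hinj : Function.Injective a) :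
    Dense (Set.range a) := by
  have hadj : a.adjoint = a := LinearPMap.isSelfAdjoint_def.mp ha.selfAdjoint
  have htop : (LinearMap.range a.toFun).topologicalClosure = ⊤ := by
    rw [Submodule.topologicalClosure_eq_top_iff, Submodule.eq_bot_iff]
    intro w hw
    have hw' : ∀ x : a.domain, ⟪(0 : H), (x : H)⟫_ℂ = ⟪w, a x⟫_ℂ := fun x => by
      rw [inner_zero_left]
      exact ((Submodule.mem_orthogonal' _ w).mp hw _ (LinearMap.mem_range_self a.toFun x)).symm
    have hd : w ∈ a.adjoint.domain := a.mem_adjoint_domain_of_exists w ⟨_, hw'⟩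
    have hv : a.adjoint ⟨w, hd⟩ = 0 :=
      LinearPMap.adjoint_apply_eq ha.selfAdjoint.dense_domain _ hw'
    have hd' : w ∈ a.domain := by rw [← hadj]; exact hd
    have hle : a ≤ a.adjoint := le_of_eq hadj.symm
    have hv' : a ⟨w, hd'⟩ = 0 := (hle.2 rfl).trans hv
    exact congrArg Subtype.val (hinj (hv'.trans a.map_zero.symm))
  exact Submodule.dense_iff_topologicalClosure_eq_top.mpr htop

/-- The contraction `a (r + a)⁻¹`. -/
noncomputable def contr (M : VonNeumannAlgebra H) (a : H →ₗ.[ℂ] H) (r : ℝ) : M.toStarSubalgebra :=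
  ((r⁻¹ : ℝ) : ℂ) • approx M a r

theorem IsPosAffiliated.norm_contr_apply_le (ha : IsPosAffiliated M a) {r : ℝ} (hr : 0 < r)
    (z : H) : ‖(contr M a r : H →L[ℂ] H) z‖ ≤ ‖z‖ := by
  change ‖((r⁻¹ : ℝ) : ℂ) • (approx M a r : H →L[ℂ] H) z‖ ≤ _
  rw [norm_smul, Complex.norm_real, Real.norm_of_nonneg (inv_pos.mpr hr).le, inv_mul_le_iff₀ hr]
  exact ha.norm_approx_apply_le hr z

/-- Since `a (r + a)⁻¹` sends `r x + a x` to `a x`, the difference is `-r a (r + a)⁻¹ x`, and `a (r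
+ a)⁻¹` is a contraction. -/
theorem IsPosAffiliated.norm_contr_range_sub_le (ha : IsPosAffiliated M a) {r : ℝ} (hr : 0 < r)
    (x : a.domain) : ‖(contr M a r : H →L[ℂ] H) (a x) - a x‖ ≤ r * ‖x‖ := by
  have h : (contr M a r : H →L[ℂ] H) (shift a r x) = a x := by
    change ((r⁻¹ : ℝ) : ℂ) • (approx M a r : H →L[ℂ] H) (shift a r x) = _
    rw [ha.approx_shift hr, smul_smul, ← Complex.ofReal_mul, inv_mul_cancel₀ hr.ne',
      Complex.ofReal_one, one_smul]
  rw [shift_apply, map_add, map_smul] at h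
  have h2 : (contr M a r : H →L[ℂ] H) (a x) - a x =
      -((r : ℂ) • (contr M a r : H →L[ℂ] H) x) := by
    rw [sub_eq_iff_eq_add, ← sub_eq_neg_add, eq_sub_iff_add_eq']
    exact h
  rw [h2, norm_neg, norm_smul, Complex.norm_real, Real.norm_of_nonneg hr.le]
  exact mul_le_mul_of_nonneg_left (ha.norm_contr_apply_le hr x) hr.le

/-- If `a` is injective, `a (r + a)⁻¹` tends to `1` strongly as `r → 0`. -/
theorem IsPosAffiliated.tendsto_contr (ha : IsPosAffiliated M a) (hinj : Function.Injective a)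
    (z : H) : Filter.Tendsto (fun r : ℝ => (contr M a r : H →L[ℂ] H) z)
      (nhdsWithin 0 (Set.Ioi 0)) (nhds z) := by
  rw [Metric.tendsto_nhds]
  intro ε hε
  -- Replacing `z` by a nearby `a x` costs `ε / 3` twice, uniformly in `r` by contractivity; on `a
  -- x` the error is at most `r ‖x‖`.
  obtain ⟨_, hx, ⟨x, rfl⟩⟩ := Metric.dense_iff.mp (ha.dense_range hinj) z (ε / 3) (by positivity)
  rw [Metric.mem_ball, dist_eq_norm] at hx
  have h1 : Filter.Tendsto (fun r : ℝ => r * ‖(x : H)‖) (nhdsWithin 0 (Set.Ioi 0)) (nhds 0) := by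
    have : Filter.Tendsto (fun r : ℝ => r * ‖(x : H)‖) (nhds 0) (nhds (0 * ‖(x : H)‖)) :=
      Filter.tendsto_id.mul_const _
    rw [zero_mul] at this
    exact this.mono_left nhdsWithin_le_nhds
  filter_upwards [h1.eventually_lt_const (show 0 < ε / 3 by positivity), self_mem_nhdsWithin]
    with r hr1 hr
  rw [dist_eq_norm]
  have h2 := ha.norm_contr_apply_le hr (z - a x)
  have h3 := ha.norm_contr_range_sub_le hr x
  have h4 : (contr M a r : H →L[ℂ] H) z - z = (contr M a r : H →L[ℂ] H) (z - a x) +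
      ((contr M a r : H →L[ℂ] H) (a x) - a x) + (a x - z) := by
    rw [map_sub]
    abel
  rw [h4]
  rw [norm_sub_rev z (a x)] at h2
  have h5 := norm_add₃_le (a := (contr M a r : H →L[ℂ] H) (z - a x))
    (b := (contr M a r : H →L[ℂ] H) (a x) - a x) (c := a x - z)
  calc _ ≤ _ := h5
    _ ≤ ‖a x - z‖ + r * ‖(x : H)‖ + ‖a x - z‖ := add_le_add_left (add_le_add h2 h3) _
    _ < ε / 3 + ε / 3 + ε / 3 := add_lt_add (add_lt_add hx hr1) hx
    _ = ε := by ring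

/-- Dominated convergence in the series representing the normal functional `φ`: each term converges
by strong convergence, and contractivity gives a summable bound independent of `r`. -/
theorem IsPosAffiliated.tendsto_conj_contr (ha : IsPosAffiliated M a)
    (hinj : Function.Injective a) {φ : M.toStarSubalgebra →ₗ[ℂ] ℂ} (hφ : φ ∈ predual M)
    (z : M.toStarSubalgebra) :
    Filter.Tendsto (fun r : ℝ => φ (contr M a r * z * contr M a r))
      (nhdsWithin 0 (Set.Ioi 0)) (nhds (φ z)) := by
  obtain ⟨f, g, hf, hg, h⟩ := hφ
  have hfun : (fun r : ℝ => φ (contr M a r * z * contr M a r)) = fun r : ℝ =>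
      ∑' n, ⟪g n, (contr M a r : H →L[ℂ] H) ((z : H →L[ℂ] H)
        ((contr M a r : H →L[ℂ] H) (f n)))⟫_ℂ :=
    funext fun r => (h _).tsum_eq.symm
  rw [hfun, ← (h z).tsum_eq]
  refine tendsto_tsum_of_dominated_convergence
    (bound := fun n => ‖(z : H →L[ℂ] H)‖ * (‖f n‖ ^ 2 + ‖g n‖ ^ 2))
    ((hf.add hg).mul_left _) (fun n => ?_) ?_
  · refine Filter.Tendsto.inner tendsto_const_nhds ?_
    rw [tendsto_iff_norm_sub_tendsto_zero]
    -- With `c = a (r + a)⁻¹`, split `c z c f - z f = c (z c f - z f) + (c z f - z f)`; the outer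
    -- `c` in the first term does not increase norms.
    have h1 := ha.tendsto_contr hinj ((z : H →L[ℂ] H) (f n))
    have h2 := (((z : H →L[ℂ] H).continuous.tendsto _).comp (ha.tendsto_contr hinj (f n)))
    rw [tendsto_iff_norm_sub_tendsto_zero] at h1 h2
    refine squeeze_zero' (Filter.Eventually.of_forall fun r => norm_nonneg _) ?_
      (by simpa using h2.add h1)
    filter_upwards [self_mem_nhdsWithin] with r hr
    have h3 := ha.norm_contr_apply_le hr ((z : H →L[ℂ] H) ((contr M a r : H →L[ℂ] H) (f n)) -
      (z : H →L[ℂ] H) (f n))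
    rw [map_sub] at h3
    refine (norm_sub_le_norm_sub_add_norm_sub _ _ _).trans (add_le_add_left h3 _)
  · filter_upwards [self_mem_nhdsWithin] with r hr n
    have h1 := norm_inner_le_norm (𝕜 := ℂ) (g n) ((contr M a r : H →L[ℂ] H) ((z : H →L[ℂ] H)
        ((contr M a r : H →L[ℂ] H) (f n))))
    have h2 := ha.norm_contr_apply_le hr ((z : H →L[ℂ] H) ((contr M a r : H →L[ℂ] H) (f n)))
    have h3 := (z : H →L[ℂ] H).le_opNorm ((contr M a r : H →L[ℂ] H) (f n))
    have h4 := mul_le_mul_of_nonneg_left (ha.norm_contr_apply_le hr (f n))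
      (norm_nonneg (z : H →L[ℂ] H))
    calc _ ≤ ‖g n‖ * (‖(z : H →L[ℂ] H)‖ * ‖f n‖) :=
          h1.trans (mul_le_mul_of_nonneg_left (h2.trans (h3.trans h4)) (norm_nonneg _))
      _ = ‖(z : H →L[ℂ] H)‖ * (‖f n‖ * ‖g n‖) := by ring
      _ ≤ _ := mul_le_mul_of_nonneg_left
          (by nlinarith [sq_nonneg (‖f n‖ - ‖g n‖), sq_nonneg ‖f n‖, sq_nonneg ‖g n‖])
          (norm_nonneg _)

theorem mem_predual_of_mem_DHerm {φ : M.toStarSubalgebra →ₗ[ℂ] ℂ} (hφ : φ ∈ DHerm M a) :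
    φ ∈ predual M := by
  obtain ⟨φ₁, h₁, φ₂, h₂, rfl⟩ := hφ
  exact sub_mem h₁.1.1 h₂.1.1

theorem IsPosAffiliated.isNorm_seminormA (ha : IsPosAffiliated M a)
    (hinj : Function.Injective a) : IsNorm (seminormA M a) := by
  rintro ⟨φ, hφ⟩ h0
  rw [seminormA_apply] at h0
  refine Subtype.ext (LinearMap.ext fun z => ?_)
  refine tendsto_nhds_unique (ha.tendsto_conj_contr hinj (mem_predual_of_mem_DHerm hφ) z)
    (tendsto_const_nhds.congr' ?_)
  filter_upwards [self_mem_nhdsWithin] with r hr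
  -- Up to the factor `r⁻²` this is `φ(a_r z a_r)`, so the convergent family is identically `0` for
  -- `r > 0`.
  rw [contr, smul_mul_assoc, smul_mul_assoc, mul_smul_comm, map_smul, map_smul,
    ha.conj_eq_zero hφ h0 hr, smul_zero, smul_zero]
  rfl

/-! ### Kernel vectors give functionals of zero seminorm. -/

/-- The vector functional `z ↦ ⟪x, z x⟫`. -/
noncomputable def vectorFunctional (M : VonNeumannAlgebra H) (x : H) : M.toStarSubalgebra →ₗ[ℂ] ℂ where
  toFun z := ⟪x, (z : H →L[ℂ] H) x⟫_ℂ
  map_add' _ _ := inner_add_right _ _ _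
  map_smul' _ _ := inner_smul_right _ _ _

theorem vectorFunctional_apply (x : H) (z : M.toStarSubalgebra) :
    vectorFunctional M x z = ⟪x, (z : H →L[ℂ] H) x⟫_ℂ := rfl

theorem vectorFunctional_mem_predualPos (x : H) : vectorFunctional M x ∈ predualPos M := by
  have hs : Summable fun n : ℕ => ‖Pi.single (M := fun _ => H) 0 x n‖ ^ 2 :=
    summable_of_ne_finset_zero (s := {0}) fun n hn => by
      simp [Pi.single_eq_of_ne (Finset.notMem_singleton.mp hn)]
  refine ⟨⟨Pi.single 0 x, Pi.single 0 x, hs, hs, fun z => ?_⟩, fun z hz => ?_⟩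
  · convert hasSum_single (0 : ℕ) fun n hn => ?_
    · simp [vectorFunctional_apply]
    · simp [Pi.single_eq_of_ne hn]
  · obtain ⟨h1, h2⟩ := (ContinuousLinearMap.isPositive_iff_complex _).mp hz x
    rw [vectorFunctional_apply, ← inner_conj_symm, ← h1]
    exact ⟨by simpa using h2, by simp⟩

theorem IsPosAffiliated.value_vectorFunctional_of_apply_eq_zero (ha : IsPosAffiliated M a)
    {x : a.domain} (hx : a x = 0) : value M a (vectorFunctional M (x : H)) = 0 := by
  refine tendsto_nhds_unique (ha.tendsto_value (vectorFunctional_mem_predualPos _))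
    (tendsto_const_nhds.congr' ?_)
  filter_upwards [Filter.eventually_gt_atTop (0 : ℝ)] with r hr
  -- As `a x = 0`, `(r + a) x` is just `r x`, and `a_r` sends it to `0`; hence `a_r x = 0`.
  have h := ha.approx_apply hr x
  rw [hx, add_zero, smul_zero, map_smul, smul_eq_zero_iff_right
    (Complex.ofReal_ne_zero.mpr hr.ne')] at h
  rw [vectorFunctional_apply, h, inner_zero_right, Complex.zero_re, ENNReal.ofReal_zero]

theorem IsPosAffiliated.injective_of_isNorm (ha : IsPosAffiliated M a)
    (h : IsNorm (seminormA M a)) : Function.Injective a := by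
  change Function.Injective a.toFun
  rw [injective_iff_map_eq_zero]
  intro x hx
  have hv := ha.value_vectorFunctional_of_apply_eq_zero hx
  have hD : vectorFunctional M (x : H) ∈ DPos M a :=
    ⟨vectorFunctional_mem_predualPos _, by rw [hv]; exact ENNReal.zero_lt_top⟩
  have hH : vectorFunctional M (x : H) ∈ DHerm M a := ⟨_, hD, 0, zero_mem_DPos, (sub_zero _).symm⟩
  have h0 : seminormA M a ⟨_, hH⟩ = 0 := by
    rw [seminormA_apply]
    refine le_antisymm (csInf_le (normSet_bddBelow _) ?_)
      (le_csInf (normSet_nonempty hH) fun _ ht => normSet_nonneg ht)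
    exact ⟨_, hD, 0, zero_mem_DPos, (sub_zero _).symm, by simp [hv, value_zero]⟩
  have h1 : vectorFunctional M (x : H) 1 = 0 := by
    have h2 : vectorFunctional M (x : H) = 0 := congrArg Subtype.val (h _ h0)
    rw [h2, LinearMap.zero_apply]
  exact Subtype.ext (inner_self_eq_zero.mp h1)

end OperatorL1

theorem mainTheorem1 {H : Type*} [NormedAddCommGroup H] [InnerProductSpace ℂ H] [CompleteSpace H]
    (M : VonNeumannAlgebra H) (a : H →ₗ.[ℂ] H) (ha : OperatorL1.IsPosAffiliated M a) :
    OperatorL1.IsNorm (OperatorL1.seminormA M a) ↔ Function.Injective a :=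
  ⟨ha.injective_of_isNorm, ha.isNorm_seminormA⟩
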